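/- Let $M$ be a smooth $n$-manifold (Hausdorff, second countable, without boundary) with a smooth Riemannian metric $g$. Let $D\subset M$ be a quasi-Lipschitz domain (defined below) with compact closure and non-empty boundary $\partial D$. Then for all real numbers $a\neq b$ there is no function $u\in W^{1,2}(M)$ with $u=a$ almost everywhere in $D$ and $u=b$ almost everywhere in $M\setminus D$. Here $W^{1,2}(M)$ is the space of functions that are square integrable for the Riemannian volume and have a square integrable weak gradient. **Lipschitz boundary points.** A simple domain is an open subset of a Euclidean space diffeomorphic to a ball. A triple $(U,\Gamma,V)$ is a Lipschitz triple in $\mathbb R^n$ if $U\subset\mathbb R^n$ and $V\subset\mathbb R^{n-1}$ are simple domains, $\Gamma\subset\partial U$, and in suitable Euclidean coordinates $(x,r)\in\mathbb R^{n-1}\times\mathbb R$ one has $U=\{x\in V,\ w(x)<r<w'(x)\}$ and $\Gamma=\{x\in V,\ r=w(x)\}$ for functions $w<w'$ on $V$ with $w$ Lipschitz. The boundary of $D$ is Lipschitz at $p\in\partial D$ if there is a smooth chart $\psi:W\to\mathbb R^n$ of $M$ with $p\in W$ such that $(\psi(D\cap W),\psi(\partial D\cap W),V)$ is a Lipschitz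 triple for some $V$. **Cones.** For $A\subset\mathbb R^m$ and $B\subset\mathbb R^\ell$ put $C_0(A\times B)=\{t(x,y): t\ge 0,\ x\in A,\ y\in B\}\subset\mathbb R^{m+\ell}$; whenever this is used it is required that $0\notin A\times B$ and that $(x,y)\mapsto (x,y)/\sqrt{|x|^2+|y|^2}$ is injective on $A\times B$. A map between arbitrary subsets of manifolds is called smooth if near each point it agrees with a smooth map on an open set. A set $G\subset M$ with $p\in G$ is diffeomorphic under $\lambda$ into $C_0(A\times B)$ relative to $p$ if $\lambda(p)=0$, $\lambda$ is a homeomorphism of $G$ onto a neighbourhood of $0$ in $C_0(A\times B)$ and a diffeomorphism of $G\setminus\{p\}$ onto $\lambda(G)\setminus\{0\}$, and for all $x\in A$, $y\in B$ the curve $t\mapsto\lambda^{-1}(t(x,y))$, $t\ge0$, is differentiable at $t=0$ with non-zero velocity. **Quasi-Lipschitz domains.** A connected, non-empty open set $D\subset M$ is a quasi-Lipschitz domain if there are a smooth $n$-manifold $N$ (Hausdorff, second countable, without boundary), a connected, non-empty open set $\Omega\subset N$ with compact closure and smooth boundary (near each boundary point, $\Omega$ is an open half-space in a suitable smooth chart)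 and a map $\varphi$, smooth on a neighbourhood of $\overline\Omega$, that restricts to a diffeomorphism $\Omega\to D$, with $\varphi(\partial\Omega)=\partial D$, and a finite (possibly empty) set $P\subset\partial D$ of glued points, such that: 1. $\varphi$ restricts to a homeomorphism of $\partial\Omega\setminus\varphi^{-1}(P)$ onto $\partial D\setminus P$, and $\partial D$ is Lipschitz at every point of $\partial D\setminus P$. 2. For each $p\in P$ there is an integer $k$ with $0\le k<n-1$ such that $\alpha:=\varphi^{-1}(p)\cap\partial\Omega$ is a finite set if $k=0$, and if $k>0$ it is a compact connected $k$-dimensional smooth submanifold (without boundary) of $\partial\Omega$ at each point of which $\varphi^*g$ is degenerate. 3. For each $p\in P$, with $k$ and $\alpha$ as in 2, $D$ has a sector domain around $p$: there are a set $A\subset\mathbb R^{k+1}$ diffeomorphic to $\alpha$, an open ball $B\subset\mathbb R^{n-1-k}$ of positive radius with boundary sphere $S$, an open neighbourhood $O$ of $p$ in $M$ and a map $\lambda$ on $O\cap\overline D$, with an inverse $\lambda^{-1}$, such that $(O\cap D)\cup\{p\}$ and $O\cap\partial D$ are diffeomorphic under $\lambda$ into $C_0(A\times B)$ and $C_0(A\times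 S)$, respectively, relative to $p$; and for all $x\in A$ and $y\ne y'$ in $S$, the unit vectors tangent at $t=0$ to the curves $\lambda^{-1}(t(x,y))$ and $\lambda^{-1}(t(x,y'))$, $t\ge0$, are distinct. -/

import Mathlib

open scoped Manifold ContDiff Topology
open MeasureTheory Set

noncomputable section

namespace QuasiLip

/-- Euclidean `n`-space. -/
abbrev Euc (n : ℕ) : Type := EuclideanSpace ℝ (Fin n)

/-- Smooth Riemannian metrics on a smooth `n`-manifold `M`. -/
abbrev SmoothMetric (n : ℕ) (M : Type*) [TopologicalSpace M] [ChartedSpace (Euc n) M]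
    [IsManifold (𝓡 n) ∞ M] : Type _ :=
  Bundle.ContMDiffRiemannianMetric (𝓡 n) ∞ (Euc n) (fun x : M => TangentSpace (𝓡 n) x)

/-! ### The Riemannian volume measure and the Sobolev space of order one -/

section Sobolev

variable {n : ℕ} {M : Type*} [TopologicalSpace M] [ChartedSpace (Euc n) M]
  [IsManifold (𝓡 n) ∞ M]

/-- The coordinate vector at the point with coordinates `y` in the chart `e`, in the direction
`v` of Euclidean space: a tangent vector of `M` at `e.symm y`. -/
def coordVec (e : OpenPartialHomeomorph M (Euc n)) (y v : Euc n) :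
    TangentSpace (𝓡 n) (e.symm y) :=
  mfderiv (𝓡 n) (𝓡 n) e.symm y v

/-- The matrix `(g_{ij})` of the metric in the chart `e`. -/
def gramMatrix (g : SmoothMetric n M) (e : OpenPartialHomeomorph M (Euc n)) (y : Euc n) :
    Matrix (Fin n) (Fin n) ℝ :=
  Matrix.of fun i j => g.inner (e.symm y)
    (coordVec e y (EuclideanSpace.single i 1)) (coordVec e y (EuclideanSpace.single j 1))

/-- The Riemannian length of a tangent vector. -/
def length (g : SmoothMetric n M) (x : M) (v : TangentSpace (𝓡 n) x) : ℝ :=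
  √(g.inner x v v)

variable [MeasurableSpace M] [BorelSpace M]

/-- The Riemannian volume of the domain of the chart `e`: the measure
`√(det g_{ij}) dx¹ ⋯ dxⁿ` on the range of the chart, transported to `M`. -/
def chartVolume (g : SmoothMetric n M) (e : OpenPartialHomeomorph M (Euc n)) : Measure M :=
  ((volume.restrict e.target).withDensity
    (fun y => ENNReal.ofReal (√((gramMatrix g e y).det)))).map e.symm

/-- The Riemannian volume measure: the smallest measure that dominates the Riemannian volume
of every chart domain. On a second countable manifold, it is the unique Borel measure which
is given by `√(det g_{ij}) dx¹ ⋯ dxⁿ` on each chart domain. -/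
def riemannianVolume (g : SmoothMetric n M) : Measure M :=
  ⨆ e ∈ IsManifold.maximalAtlas (𝓡 n) ∞ M, chartVolume g e

/-- The vector field `X` is a weak gradient of the function `u`: in each chart `e`, and for each
coordinate direction `v`, the function `⟨X, v⟩_g` is the weak derivative of `u` in the
direction `v`. (Square integrability of `u` and `X` is required in `MemW12`.) -/
def IsWeakGradient (g : SmoothMetric n M) (u : M → ℝ)
    (X : (x : M) → TangentSpace (𝓡 n) x) : Prop :=
  ∀ e ∈ IsManifold.maximalAtlas (𝓡 n) ∞ M, ∀ v : Euc n,
    AEStronglyMeasurable (fun y => g.inner (e.symm y) (X (e.symm y)) (coordVec e y v))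
      (volume.restrict e.target) ∧
    ∀ η : Euc n → ℝ, ContDiff ℝ ∞ η → HasCompactSupport η → tsupport η ⊆ e.target →
      ∫ y in e.target, u (e.symm y) * fderiv ℝ η y v =
        - ∫ y in e.target, g.inner (e.symm y) (X (e.symm y)) (coordVec e y v) * η y

/-- Membership in the Sobolev space `W^{1,2}(M)`: square integrable functions that have a
square integrable weak gradient. -/
def MemW12 (g : SmoothMetric n M) (u : M → ℝ) : Prop :=
  MemLp u 2 (riemannianVolume g) ∧
  ∃ X : (x : M) → TangentSpace (𝓡 n) x, IsWeakGradient g u X ∧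
    MemLp (fun x => length g x (X x)) 2 (riemannianVolume g)

end Sobolev

/-! ### Lipschitz triples and Lipschitz boundary points -/

/-- An open set in Euclidean space that is diffeomorphic to a ball. -/
def IsSimpleDomain {n : ℕ} (U : Set (Euc n)) : Prop :=
  ∃ Φ : PartialDiffeomorph (𝓡 n) (𝓡 n) (Euc n) (Euc n) ∞,
    Φ.source = Metric.ball 0 1 ∧ Φ.target = U

/-- `(U, Γ, V)` is a Lipschitz triple in `ℝⁿ`: in suitable Euclidean coordinates `(x, r)`,
`U` is the set of points with `x ∈ V`, `w x < r < w' x`, and `Γ ⊆ ∂U` is the graph of `w`, where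
`w` is Lipschitz. -/
def IsLipschitzTriple {n : ℕ} (U Γ : Set (Euc n)) (V : Set (Euc (n - 1))) : Prop :=
  IsSimpleDomain U ∧ IsSimpleDomain V ∧ Γ ⊆ frontier U ∧
  ∃ (c : Euc n ≃ₗᵢ[ℝ] WithLp 2 (Euc (n - 1) × ℝ)) (w w' : Euc (n - 1) → ℝ) (L : NNReal),
    LipschitzOnWith L w V ∧ (∀ x ∈ V, w x < w' x) ∧
    U = {z | (c z).fst ∈ V ∧ w (c z).fst < (c z).snd ∧ (c z).snd < w' (c z).fst} ∧
    Γ = {z | (c z).fst ∈ V ∧ (c z).snd = w (c z).fst}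

section Manifolds

variable {n : ℕ} {M : Type*} [TopologicalSpace M] [ChartedSpace (Euc n) M]

/-- The boundary of `D` is Lipschitz at `p`: there is a smooth chart `(W, ψ)` at `p` such that
`(ψ(D ∩ W), ψ(∂D ∩ W), V)` is a Lipschitz triple for some `V`. -/
def IsLipschitzAt (D : Set M) (p : M) : Prop :=
  ∃ ψ ∈ IsManifold.maximalAtlas (𝓡 n) ∞ M, p ∈ ψ.source ∧
    ∃ V : Set (Euc (n - 1)),
      IsLipschitzTriple (ψ '' (D ∩ ψ.source)) (ψ '' (frontier D ∩ ψ.source)) V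

/-- The open set `Ω` has smooth boundary: near each boundary point it is, in a suitable smooth
chart, an open half-space. -/
def HasSmoothBoundary (Ω : Set M) : Prop :=
  ∀ q ∈ frontier Ω, ∃ e ∈ IsManifold.maximalAtlas (𝓡 n) ∞ M, q ∈ e.source ∧
    ∃ i : Fin n, ∀ x ∈ e.source, x ∈ Ω ↔ 0 < e x i

/-- `α` is a `k`-dimensional (embedded) smooth submanifold of the smooth boundary of `Ω`: near
each point of `α` there is a smooth chart in which `Ω` is an open half-space and `α` is a slice
of the boundary hyperplane, cut out by the vanishing of `n - k` coordinates. -/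
def IsBoundarySubmanifold (Ω : Set M) (k : ℕ) (α : Set M) : Prop :=
  α ⊆ frontier Ω ∧
  ∀ q ∈ α, ∃ e ∈ IsManifold.maximalAtlas (𝓡 n) ∞ M, q ∈ e.source ∧
    ∃ (i : Fin n) (s : Finset (Fin n)), i ∈ s ∧ s.card + k = n ∧
      (∀ x ∈ e.source, x ∈ Ω ↔ 0 < e x i) ∧
      (∀ x ∈ e.source, x ∈ α ↔ ∀ j ∈ s, e x j = 0)

end Manifolds

/-! ### Smooth maps on arbitrary subsets, and cones -/

/-- A map is smooth on an arbitrary subset `S` of a manifold if, near each point of `S`, it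
agrees on `S` with a smooth map that is defined on an open set. -/
def SmoothOnSubset {E H E' H' : Type*} [NormedAddCommGroup E] [NormedSpace ℝ E]
    [TopologicalSpace H] (I : ModelWithCorners ℝ E H)
    [NormedAddCommGroup E'] [NormedSpace ℝ E'] [TopologicalSpace H']
    (I' : ModelWithCorners ℝ E' H') {X X' : Type*}
    [TopologicalSpace X] [ChartedSpace H X] [TopologicalSpace X'] [ChartedSpace H' X']
    (f : X → X') (S : Set X) : Prop :=
  ∀ x ∈ S, ∃ O : Set X, IsOpen O ∧ x ∈ O ∧
    ∃ F : X → X', ContMDiffOn I I' ∞ F O ∧ EqOn F f (O ∩ S)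

/-- `f` restricts to a diffeomorphism from the subset `S` onto the subset `T`, with inverse
`f'`. -/
def IsSubsetDiffeo {E H E' H' : Type*} [NormedAddCommGroup E] [NormedSpace ℝ E]
    [TopologicalSpace H] (I : ModelWithCorners ℝ E H)
    [NormedAddCommGroup E'] [NormedSpace ℝ E'] [TopologicalSpace H']
    (I' : ModelWithCorners ℝ E' H') {X X' : Type*}
    [TopologicalSpace X] [ChartedSpace H X] [TopologicalSpace X'] [ChartedSpace H' X']
    (f : X → X') (f' : X' → X) (S : Set X) (T : Set X') : Prop :=
  f '' S = T ∧ LeftInvOn f' f S ∧ SmoothOnSubset I I' f S ∧ SmoothOnSubset I' I f' T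

section Cones

variable {m l : ℕ}

/-- The cone with vertex `0` and base `A × B` in `ℝᵐ × ℝˡ`. -/
def cone (A : Set (Euc m)) (B : Set (Euc l)) : Set (Euc m × Euc l) :=
  {z | ∃ t : ℝ, 0 ≤ t ∧ ∃ x ∈ A, ∃ y ∈ B, z = t • (x, y)}

/-- The normalization map of `ℝᵐ × ℝˡ = ℝᵐ⁺ˡ` onto the Euclidean unit sphere. -/
def normalization (z : Euc m × Euc l) : Euc m × Euc l :=
  (√(‖z.1‖ ^ 2 + ‖z.2‖ ^ 2))⁻¹ • z

/-- `A × B` does not contain the origin and is mapped injectively to the unit sphere by the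
normalization map, so that `cone A B` is a cone with base `A × B`. -/
def IsConeBase (A : Set (Euc m)) (B : Set (Euc l)) : Prop :=
  (0 : Euc m × Euc l) ∉ A ×ˢ B ∧ InjOn normalization (A ×ˢ B)

variable {n : ℕ} {M : Type*} [TopologicalSpace M] [ChartedSpace (Euc n) M]

/-- The curve `t ↦ κ (t z)`, written in the preferred chart at `p`. -/
def rayInChart (p : M) (κ : Euc m × Euc l → M) (z : Euc m × Euc l) (t : ℝ) : Euc n :=
  extChartAt (𝓡 n) p (κ (t • z))

/-- The one-sided velocity at `t = 0` of the curve `t ↦ κ (t z)`, `t ≥ 0`, starting at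
`p = κ 0`; tangent vectors at `p` are identified with vectors of `ℝⁿ` by the preferred chart
at `p`. -/
def rayVelocity (p : M) (κ : Euc m × Euc l → M) (z : Euc m × Euc l) : TangentSpace (𝓡 n) p :=
  (derivWithin (rayInChart (n := n) p κ z) (Ici 0) 0 : Euc n)

/-- The set `G ∋ p` is diffeomorphic, under the map `lam` with inverse `κ`, into the cone over
`A × B`, relative to `p`. -/
structure IsDiffeoIntoCone (G : Set M) (p : M) (lam : M → Euc m × Euc l)
    (κ : Euc m × Euc l → M) (A : Set (Euc m)) (B : Set (Euc l)) : Prop where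
  mem : p ∈ G
  map_vertex : lam p = 0
  mapsTo : MapsTo lam G (cone A B)
  image_mem_nhds : lam '' G ∈ 𝓝[cone A B] 0
  leftInv : LeftInvOn κ lam G
  continuousOn : ContinuousOn lam G
  continuousOn_inv : ContinuousOn κ (lam '' G)
  diffeo : IsSubsetDiffeo (𝓡 n) 𝓘(ℝ, Euc m × Euc l) lam κ (G \ {p}) (lam '' G \ {0})
  ray_differentiable : ∀ x ∈ A, ∀ y ∈ B,
    DifferentiableWithinAt ℝ (rayInChart (n := n) p κ (x, y)) (Ici 0) 0
  ray_velocity_ne : ∀ x ∈ A, ∀ y ∈ B, rayVelocity (n := n) p κ (x, y) ≠ 0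

end Cones

/-! ### Gluing maps and quasi-Lipschitz domains -/

section Gluing

variable {n : ℕ} {M : Type*} [TopologicalSpace M] [ChartedSpace (Euc n) M]
  [IsManifold (𝓡 n) ∞ M]
  {N : Type*} [TopologicalSpace N] [ChartedSpace (Euc n) N] [IsManifold (𝓡 n) ∞ N]

/-- The preglued set of a point `p`: its preimage under the gluing map in `∂Ω`. -/
def preglued (φ : N → M) (Ω : Set N) (p : M) : Set N :=
  frontier Ω ∩ φ ⁻¹' {p}

/-- The unit vector tangent at `p` to the curve `t ↦ κ (t z)`, `t ≥ 0`. -/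
def rayUnitVector {m l : ℕ} (g : SmoothMetric n M) (p : M) (κ : Euc m × Euc l → M)
    (z : Euc m × Euc l) : TangentSpace (𝓡 n) p :=
  (length g p (rayVelocity p κ z))⁻¹ • rayVelocity p κ z

/-- Around `p ∈ ∂D`, the domain `D` has a sector domain with preglued set `α` of dimension `k`.
Here `A` is a copy of `α` in `ℝᵏ⁺¹`, and the open ball `B^{n-1-k}` and its boundary sphere
`S^{n-2-k}` lie in `ℝⁿ⁻¹⁻ᵏ`. -/
def HasSectorDomain (g : SmoothMetric n M) (D : Set M) (p : M) (k : ℕ) (α : Set N) : Prop :=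
  ∃ (A : Set (Euc (k + 1))) (ι : N → Euc (k + 1)) (ι' : Euc (k + 1) → N)
    (c : Euc (n - 1 - k)) (ρ : ℝ),
    IsSubsetDiffeo (𝓡 n) (𝓡 (k + 1)) ι ι' α A ∧ 0 < ρ ∧
    IsConeBase A (Metric.ball c ρ) ∧ IsConeBase A (Metric.sphere c ρ) ∧
    ∃ (O : Set M) (lam : M → Euc (k + 1) × Euc (n - 1 - k))
      (κ : Euc (k + 1) × Euc (n - 1 - k) → M),
      IsOpen O ∧ p ∈ O ∧
      IsDiffeoIntoCone (n := n) (insert p (O ∩ D)) p lam κ A (Metric.ball c ρ) ∧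
      IsDiffeoIntoCone (n := n) (O ∩ frontier D) p lam κ A (Metric.sphere c ρ) ∧
      ∀ x ∈ A, ∀ y ∈ Metric.sphere c ρ, ∀ y' ∈ Metric.sphere c ρ, y ≠ y' →
        rayUnitVector g p κ (x, y) ≠ rayUnitVector g p κ (x, y')

/-- The pullback under `φ` of the metric `g` is degenerate at `q`. -/
def IsPullbackDegenerateAt (g : SmoothMetric n M) (φ : N → M) (q : N) : Prop :=
  ∃ v : TangentSpace (𝓡 n) q, v ≠ 0 ∧ ∀ w : TangentSpace (𝓡 n) q,
    g.inner (φ q) (mfderiv (𝓡 n) (𝓡 n) φ q v) (mfderiv (𝓡 n) (𝓡 n) φ q w) = 0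

/-- `p` is an admissible glued point of `D = φ(Ω)`: its preglued set is, for some
`0 ≤ k < n - 1`, a finite set (`k = 0`) or a compact connected `k`-dimensional submanifold of `∂Ω`
along which the pullback metric is degenerate (`k > 0`), and `D` has a sector domain around
`p`. -/
def IsGluedPoint (g : SmoothMetric n M) (φ : N → M) (Ω : Set N) (D : Set M) (p : M) : Prop :=
  ∃ k : ℕ, k + 1 < n ∧
    ((k = 0 ∧ (preglued φ Ω p).Finite) ∨
      (0 < k ∧ IsBoundarySubmanifold (n := n) Ω k (preglued φ Ω p) ∧
        IsConnected (preglued φ Ω p) ∧ IsCompact (preglued φ Ω p) ∧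
        ∀ q ∈ preglued φ Ω p, IsPullbackDegenerateAt g φ q)) ∧
    HasSectorDomain g D p k (preglued φ Ω p)

/-- `φ` is a gluing map of the domain `D` of the Riemannian manifold `(M, g)`, with sample
domain `Ω` in the sample space `N`. Only the values of `φ` on a neighbourhood `Ω'` of the closure
of `Ω` matter. -/
structure IsGluingMap (g : SmoothMetric n M) (φ : N → M) (Ω : Set N) (D : Set M) : Prop where
  isOpen_sample : IsOpen Ω
  isConnected_sample : IsConnected Ω
  isCompact_closure_sample : IsCompact (closure Ω)
  smooth_boundary : HasSmoothBoundary (n := n) Ω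
  smooth_extension : ∃ Ω' : Set N, IsOpen Ω' ∧ closure Ω ⊆ Ω' ∧ ContMDiffOn (𝓡 n) (𝓡 n) ∞ φ Ω'
  diffeo : ∃ Φ : PartialDiffeomorph (𝓡 n) (𝓡 n) N M ∞,
    Φ.source = Ω ∧ Φ.target = D ∧ EqOn φ Φ Ω
  image_frontier : φ '' frontier Ω = frontier D
  glued : ∃ P : Set M, P.Finite ∧ P ⊆ frontier D ∧
    (∀ p ∈ P, IsGluedPoint g φ Ω D p) ∧
    (∃ h : ↥(frontier Ω \ φ ⁻¹' P) ≃ₜ ↥(frontier D \ P), ∀ q, (h q : M) = φ q) ∧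
    ∀ p ∈ frontier D \ P, IsLipschitzAt (n := n) D p

end Gluing

/-- `D` is a quasi-Lipschitz domain of the Riemannian manifold `(M, g)`: a connected open set
that is the image of a sample domain under a gluing map. (Every Hausdorff second countable manifold
is diffeomorphic to one in `Type`, so that the universe of sample spaces is no restriction.) -/
def IsQuasiLipschitzDomain {n : ℕ} {M : Type*} [TopologicalSpace M] [ChartedSpace (Euc n) M]
    [IsManifold (𝓡 n) ∞ M] (g : SmoothMetric n M) (D : Set M) : Prop :=
  IsOpen D ∧ IsConnected D ∧
  ∃ (N : Type) (_ : TopologicalSpace N) (_ : T2Space N) (_ : SecondCountableTopology N)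
    (_ : ChartedSpace (Euc n) N) (_ : IsManifold (𝓡 n) ∞ N) (φ : N → M) (Ω : Set N),
    IsGluingMap g φ Ω D

end QuasiLip

end

namespace QuasiLip

/-! ### The metric and its Gram matrix in a chart -/

section MetricInCharts

variable {n : ℕ} {M : Type*} [TopologicalSpace M] [ChartedSpace (Euc n) M]

/-! The obstruction is local: one Lipschitz boundary point of `D` already excludes a jump. In a
chart at such a point, a small ball is, up to the Lebesgue null Lipschitz graph, the union of two
nonempty open sets: one in `D`, where the function is `a`, and one in the exterior of `D`, where it
is `b`. The weak derivatives are locally integrable functions and vanish on both open sets, hence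
almost everywhere on the ball; no singular part can sit on the graph. A mollification of the step
function is therefore constant along a segment joining the two sides, while it equals `a` at one end
and `b` at the other (`eq_of_weakDeriv_of_piecewise_const`).

A Lipschitz point exists because the boundary cannot consist of glued points alone
(`IsGluingMap.not_frontier_subset`). Otherwise the gluing map would take finitely many values on the
boundary of `Ω`, so by continuity it would be locally constant there. A preglued set would then
contain a relatively open piece of an `(n-1)`-dimensional boundary, which is impossible for a finite
set or a submanifold of dimension `k < n - 1`. -/

lemma coordVec_injective {e : OpenPartialHomeomorph M (Euc n)}
    (he : e ∈ IsManifold.maximalAtlas (𝓡 n) ∞ M) {y : Euc n} (hy : y ∈ e.target) {v : Euc n}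
    (hv : coordVec e y v = 0) : v = 0 := by
  have h : e.MDifferentiable (𝓡 n) (𝓡 n) :=
    ⟨(contMDiffOn_of_mem_maximalAtlas he).mdifferentiableOn (by simp),
      (contMDiffOn_symm_of_mem_maximalAtlas he).mdifferentiableOn (by simp)⟩
  exact h.symm.mfderiv_injective hy (hv.trans (map_zero _).symm)

lemma coordVec_sum (e : OpenPartialHomeomorph M (Euc n)) (y v : Euc n) :
    coordVec e y v = ∑ i, v i • coordVec e y (EuclideanSpace.single i 1) := by
  have hv : v = ∑ i, v i • EuclideanSpace.single i (1 : ℝ) := by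
    ext j; simp [Finset.sum_apply, Pi.single_apply]
  have := map_sum (mfderiv (𝓡 n) (𝓡 n) e.symm y)
    (fun i => (v i • EuclideanSpace.single i (1 : ℝ) : Euc n)) Finset.univ
  rw [coordVec]
  conv_lhs => rw [hv]
  refine this.trans (Finset.sum_congr rfl fun i _ => ?_)
  exact map_smul (mfderiv (𝓡 n) (𝓡 n) e.symm y) _ _

variable [IsManifold (𝓡 n) ∞ M]

/-- The coefficients of a smooth metric are continuous in every smooth chart. -/
lemma continuousOn_inner_coordVec (g : SmoothMetric n M) {e : OpenPartialHomeomorph M (Euc n)}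
    (he : e ∈ IsManifold.maximalAtlas (𝓡 n) ∞ M) (v w : Euc n) :
    ContinuousOn (fun y => g.inner (e.symm y) (coordVec e y v) (coordVec e y w)) e.target := by
  have hs := contMDiffOn_symm_of_mem_maximalAtlas he
  have hT := hs.continuousOn_tangentMapWithin (by norm_num)
    e.open_target.uniqueMDiffOn
  -- The tangent map of `e.symm` is continuous; applied to the constant field `v`, it gives the
  -- coordinate field as a continuous map into the tangent bundle.
  have key : ∀ v : Euc n, ContinuousOn (fun y => (Bundle.TotalSpace.mk' (Euc n)
      (E := fun x : M => TangentSpace (𝓡 n) x) (e.symm y) (coordVec e y v))) e.target := by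
    intro v
    have h1 : Continuous (fun y : Euc n => (tangentBundleModelSpaceHomeomorph (𝓡 n)).symm (y, v)) :=
      (Homeomorph.continuous _).comp (by fun_prop)
    refine (hT.comp h1.continuousOn fun y hy => hy).congr fun y hy => ?_
    simp only [Function.comp_apply, tangentMapWithin, coordVec]
    rw [mfderivWithin_of_isOpen e.open_target (by exact hy)]
    rfl
  intro y hy
  have := ContinuousWithinAt.clm_bundle_apply₂ (F₁ := Euc n) (F₂ := Euc n) (F₃ := ℝ)
    (E₃ := Bundle.Trivial M ℝ)
    ((g.contMDiff.continuous.continuousAt).comp_continuousWithinAt (e.continuousOn_symm y hy))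
    (key v y hy) (key w y hy)
  simp only [FiberBundle.continuousWithinAt_totalSpace] at this
  exact this.2

lemma metric_inner_self_nonneg (g : SmoothMetric n M) (x : M) (v : TangentSpace (𝓡 n) x) :
    0 ≤ g.inner x v v := by
  rcases eq_or_ne v 0 with rfl | hv
  · simp
  · exact (g.pos x v hv).le

/-- The quadratic form of the Gram matrix is the metric on the vector with the given coordinates.
Consequently the volume density is strictly positive, which allows passing back from the Riemannian
volume to Lebesgue measure. -/
lemma gramMatrix_posDef (g : SmoothMetric n M) {e : OpenPartialHomeomorph M (Euc n)}
    (he : e ∈ IsManifold.maximalAtlas (𝓡 n) ∞ M) {y : Euc n} (hy : y ∈ e.target) :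
    (gramMatrix g e y).PosDef := by
  refine Matrix.PosDef.of_dotProduct_mulVec_pos ?_ fun x hx => ?_
  · ext i j
    simp [gramMatrix, Matrix.conjTranspose_apply, g.symm]
  · have h : star x ⬝ᵥ (gramMatrix g e y).mulVec x =
        g.inner (e.symm y) (coordVec e y (WithLp.toLp 2 x)) (coordVec e y (WithLp.toLp 2 x)) := by
      rw [coordVec_sum]
      simp only [map_sum, map_smul, sum_apply, smul_apply,
        dotProduct, Matrix.mulVec, gramMatrix, Matrix.of_apply, smul_eq_mul, Finset.mul_sum]
      rw [Finset.sum_comm]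
      refine Finset.sum_congr rfl fun i _ => Finset.sum_congr rfl fun j _ => ?_
      simp
      ring
    rw [h]
    refine g.pos _ _ fun h0 => hx ?_
    have := coordVec_injective he hy h0
    simpa using this

/-- A crude Cauchy–Schwarz inequality, from expanding the squares of `v + w` and `v - w`. It bounds
a component of a vector field by squared lengths, without any square root. -/
lemma abs_inner_le (g : SmoothMetric n M) (x : M) (v w : TangentSpace (𝓡 n) x) :
    |g.inner x v w| ≤ g.inner x v v + g.inner x w w := by
  have h1 := metric_inner_self_nonneg g x (v + w)
  have h2 := metric_inner_self_nonneg g x (v - w)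
  have h3 := g.symm x v w
  have h4 := metric_inner_self_nonneg g x v
  have h5 := metric_inner_self_nonneg g x w
  simp only [map_add, map_sub, add_apply, sub_apply]
    at h1 h2
  rw [abs_le]
  constructor <;> linarith

lemma continuousOn_det_gramMatrix (g : SmoothMetric n M) {e : OpenPartialHomeomorph M (Euc n)}
    (he : e ∈ IsManifold.maximalAtlas (𝓡 n) ∞ M) :
    ContinuousOn (fun y => (gramMatrix g e y).det) e.target := by
  simp only [Matrix.det_apply]
  refine continuousOn_finsetSum _ fun σ _ => ContinuousOn.const_smul ?_ _
  exact continuousOn_finsetProd _ fun i _ => continuousOn_inner_coordVec g he _ _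

end MetricInCharts

/-! ### From the Riemannian volume to Lebesgue measure in charts -/

section VolumeInCharts

variable {n : ℕ} {M : Type*} [TopologicalSpace M]

lemma aemeasurable_chart_symm [MeasurableSpace M] [BorelSpace M]
    (e : OpenPartialHomeomorph M (Euc n)) :
    AEMeasurable e.symm (volume.restrict e.target) :=
  e.continuousOn_symm.aemeasurable e.open_target.measurableSet

lemma aemeasurable_chart_symm_withDensity [MeasurableSpace M] [BorelSpace M]
    (e : OpenPartialHomeomorph M (Euc n))
    (f : Euc n → ENNReal) :
    AEMeasurable e.symm ((volume.restrict e.target).withDensity f) :=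
  (aemeasurable_chart_symm e).mono_ac (withDensity_absolutelyContinuous _ _)

variable [ChartedSpace (Euc n) M] [IsManifold (𝓡 n) ∞ M]

lemma aemeasurable_density (g : SmoothMetric n M) {e : OpenPartialHomeomorph M (Euc n)}
    (he : e ∈ IsManifold.maximalAtlas (𝓡 n) ∞ M) :
    AEMeasurable (fun y => ENNReal.ofReal (√((gramMatrix g e y).det)))
      (volume.restrict e.target) :=
  ((continuousOn_det_gramMatrix g he).sqrt.aemeasurable e.open_target.measurableSet).ennreal_ofReal

variable [MeasurableSpace M]

lemma chartVolume_le_riemannianVolume (g : SmoothMetric n M)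
    {e : OpenPartialHomeomorph M (Euc n)} (he : e ∈ IsManifold.maximalAtlas (𝓡 n) ∞ M) :
    chartVolume g e ≤ riemannianVolume g :=
  le_iSup₂_of_le e he le_rfl

variable [BorelSpace M]

/-- Sets that are null for the Riemannian volume are Lebesgue null in every smooth chart. -/
lemma ae_chart_of_ae_riemannianVolume (g : SmoothMetric n M)
    {e : OpenPartialHomeomorph M (Euc n)} (he : e ∈ IsManifold.maximalAtlas (𝓡 n) ∞ M)
    {p : M → Prop} (hp : ∀ᵐ x ∂(riemannianVolume g), p x) :
    ∀ᵐ y ∂(volume.restrict e.target), p (e.symm y) := by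
  have h1 : ∀ᵐ x ∂(chartVolume g e), p x := ae_mono (chartVolume_le_riemannianVolume g he) hp
  have h2 := ae_of_ae_map (aemeasurable_chart_symm_withDensity e _) h1
  refine (withDensity_absolutelyContinuous' (aemeasurable_density g he) ?_).ae_le h2
  filter_upwards [ae_restrict_mem e.open_target.measurableSet] with y hy
  simpa using (gramMatrix_posDef g he hy).det_pos

/-- A function that is integrable for the Riemannian volume is locally integrable in every smooth
chart. -/
lemma locallyIntegrableOn_chart (g : SmoothMetric n M)
    {e : OpenPartialHomeomorph M (Euc n)} (he : e ∈ IsManifold.maximalAtlas (𝓡 n) ∞ M)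
    {q : M → ℝ} (hq : Integrable q (riemannianVolume g)) :
    LocallyIntegrableOn (fun y => q (e.symm y)) e.target := by
  have h1 : Integrable q (chartVolume g e) := hq.mono_measure (chartVolume_le_riemannianVolume g he)
  have h2 := (integrable_map_measure h1.1 (aemeasurable_chart_symm_withDensity e _)).1 h1
  rw [integrable_withDensity_iff_integrable_smul₀' (aemeasurable_density g he)
    (by simp)] at h2
  have h3 : IntegrableOn (fun y => √((gramMatrix g e y).det) * q (e.symm y)) e.target := by
    refine h2.congr (Filter.Eventually.of_forall fun y => ?_)
    simp [ENNReal.toReal_ofReal (Real.sqrt_nonneg _)]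
  -- The density is continuous and positive, so dividing by it preserves local integrability.
  have h4 : ContinuousOn (fun y => (√((gramMatrix g e y).det))⁻¹) e.target :=
    (continuousOn_det_gramMatrix g he).sqrt.inv₀ fun y hy =>
      (Real.sqrt_pos.2 (gramMatrix_posDef g he hy).det_pos).ne'
  have h5 := h3.locallyIntegrableOn.continuousOn_mul h4 e.open_target.isLocallyClosed
  refine h5.congr ?_
  filter_upwards [ae_restrict_mem e.open_target.measurableSet] with y hy
  exact inv_mul_cancel_left₀ (Real.sqrt_pos.2 (gramMatrix_posDef g he hy).det_pos).ne' _

/-- The coordinate components of a square integrable vector field are locally integrable. -/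
lemma locallyIntegrableOn_inner_coordVec (g : SmoothMetric n M)
    {e : OpenPartialHomeomorph M (Euc n)} (he : e ∈ IsManifold.maximalAtlas (𝓡 n) ∞ M)
    {X : (x : M) → TangentSpace (𝓡 n) x}
    (hX : MemLp (fun x => length g x (X x)) 2 (riemannianVolume g)) (v : Euc n)
    (hm : AEStronglyMeasurable (fun y => g.inner (e.symm y) (X (e.symm y)) (coordVec e y v))
      (volume.restrict e.target)) :
    LocallyIntegrableOn (fun y => g.inner (e.symm y) (X (e.symm y)) (coordVec e y v))
      e.target := by
  have h1 : Integrable (fun x => g.inner x (X x) (X x)) (riemannianVolume g) :=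
    hX.integrable_sq.congr (Filter.Eventually.of_forall fun x =>
      Real.sq_sqrt (metric_inner_self_nonneg g x (X x)))
  -- The dominating function: the squared length of `X`, which is integrable, plus that of the
  -- coordinate field, which is continuous.
  have h2 := (locallyIntegrableOn_chart g he h1).add
    ((continuousOn_inner_coordVec g he v v).locallyIntegrableOn e.open_target.measurableSet)
  intro x hx
  obtain ⟨t, ht, hti⟩ := h2 x hx
  refine ⟨t ∩ e.target, Filter.inter_mem ht self_mem_nhdsWithin, ?_⟩
  exact (hti.mono_set inter_subset_left).mono' (hm.mono_set inter_subset_right)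
    (Filter.Eventually.of_forall fun y => abs_inner_le g _ _ _)

end VolumeInCharts

/-! ### Functions with two values on a convex set -/

section JumpFunctions

variable {n : ℕ}

/-- Integration by parts against the constant function `1`. -/
lemma integral_fderiv_apply_eq_zero {η : Euc n → ℝ} (hη : ContDiff ℝ ∞ η)
    (hc : HasCompactSupport η) (v : Euc n) : ∫ y, fderiv ℝ η y v = 0 := by
  have hd : Continuous fun y => fderiv ℝ η y v :=
    (hη.continuous_fderiv (by simp)).clm_apply continuous_const
  have hi : Integrable (fun y => fderiv ℝ η y v) :=
    hd.integrable_of_hasCompactSupport (hc.fderiv_apply ℝ v)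
  have h := integral_mul_fderiv_eq_neg_fderiv_mul_of_integrable (μ := volume) (𝕜 := ℝ)
    (f := fun _ : Euc n => (1 : ℝ)) (g := η) (v := v) (by simp) (by simpa using hi)
    (by simpa using hη.continuous.integrable_of_hasCompactSupport hc) (fun _ _ => by fun_prop)
    (fun x _ => hη.differentiable (by simp) x)
  simpa using h

lemma fderiv_apply_eq_zero_of_notMem_tsupport {η : Euc n → ℝ} {y : Euc n} (hy : y ∉ tsupport η)
    (v : Euc n) : fderiv ℝ η y v = 0 := by
  have : fderiv ℝ η y = 0 := by
    by_contra h
    exact hy (support_fderiv_subset ℝ h)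
  simp [this]

/-- A weak derivative of a function vanishes on open sets where the function is constant. -/
lemma weakDeriv_ae_eq_zero_of_ae_const {U : Set (Euc n)} (hU : IsOpen U) {f h : Euc n → ℝ}
    {c : ℝ} {v : Euc n} (hf : ∀ᵐ y, y ∈ U → f y = c) (hh : LocallyIntegrableOn h U)
    (hw : ∀ η : Euc n → ℝ, ContDiff ℝ ∞ η → HasCompactSupport η → tsupport η ⊆ U →
      ∫ y, f y * fderiv ℝ η y v = - ∫ y, h y * η y) :
    ∀ᵐ y, y ∈ U → h y = 0 := by
  -- By the fundamental lemma of the calculus of variations, it is enough to test `h` against `η`;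
  -- since `f` is `c` on the support, the result is `-c` times the integral of a derivative of `η`.
  refine hU.ae_eq_zero_of_integral_contDiff_smul_eq_zero hh fun η hη hc hs => ?_
  have h1 : ∫ y, f y * fderiv ℝ η y v = ∫ y, c * fderiv ℝ η y v := by
    refine integral_congr_ae ?_
    filter_upwards [hf] with y hy
    by_cases hyU : y ∈ U
    · simp only [hy hyU]
    · simp [fderiv_apply_eq_zero_of_notMem_tsupport (fun h => hyU (hs h)) v]
  have h2 := hw η hη hc hs
  rw [h1, integral_const_mul, integral_fderiv_apply_eq_zero hη hc, mul_zero] at h2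
  simp only [smul_eq_mul, mul_comm (η _)]
  linarith

/-- The mollification of a function with vanishing weak gradient is constant along segments. -/
lemma normed_convolution_eq_of_weakDeriv_eq_zero {Q : Set (Euc n)} {F : Euc n → ℝ}
    (hF : LocallyIntegrable F) (φ : ContDiffBump (0 : Euc n))
    (hw : ∀ (v : Euc n) (η : Euc n → ℝ), ContDiff ℝ ∞ η → HasCompactSupport η → tsupport η ⊆ Q →
      ∫ y, F y * fderiv ℝ η y v = 0) {S : Set (Euc n)} (hS : Convex ℝ S)
    (hSQ : ∀ x ∈ S, Metric.closedBall x φ.rOut ⊆ Q) {x y : Euc n} (hx : x ∈ S) (hy : y ∈ S) :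
    convolution (φ.normed volume) F (ContinuousLinearMap.lsmul ℝ ℝ) volume x =
      convolution (φ.normed volume) F (ContinuousLinearMap.lsmul ℝ ℝ) volume y := by
  set G := convolution (φ.normed volume) F (ContinuousLinearMap.lsmul ℝ ℝ) volume
  have hφ : ContDiff ℝ ∞ (φ.normed volume) := φ.contDiff_normed
  have hφc : HasCompactSupport (φ.normed volume) := φ.hasCompactSupport_normed
  -- The derivative of the mollification at `z` is, up to sign, the integral of `F` against the
  -- derivative of the reflected bump `y ↦ φ (z - y)`, a test function supported in the closed ball
  -- about `z`, hence in `Q`.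
  have hd : ∀ z ∈ S, HasFDerivAt G (0 : Euc n →L[ℝ] ℝ) z := by
    intro z hz
    have h1 := hφc.hasFDerivAt_convolution_left (ContinuousLinearMap.lsmul ℝ ℝ)
      (hφ.of_le (by simp)) hF z
    refine h1.congr_fderiv ?_
    ext1 v
    rw [convolution_eq_swap, ContinuousLinearMap.integral_apply]
    · have h2 := hw v (fun y => φ.normed volume (z - y)) (hφ.comp (by fun_prop))
        (hφc.comp_homeomorph (Homeomorph.subLeft z)) ?_
      · have h3 : ∀ y, fderiv ℝ (fun y => φ.normed volume (z - y)) y v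
            = - fderiv ℝ (φ.normed volume) (z - y) v := by
          intro y
          have := ((hφ.differentiable (by simp) (z - y)).hasFDerivAt.comp y
            ((hasFDerivAt_id y).const_sub z)).fderiv
          have h4 : fderiv ℝ (fun y => φ.normed volume (z - y)) y = _ := this
          rw [h4]
          simp
        simp only [h3, mul_neg, integral_neg, neg_eq_zero] at h2
        simpa [mul_comm] using h2
      · intro y hy
        refine hSQ z hz ?_
        have h5 : z - y ∈ tsupport (φ.normed volume) := by
          have := tsupport_comp_eq_preimage (φ.normed volume) (Homeomorph.subLeft z)
          have h6 : tsupport (fun y => φ.normed volume (z - y)) = _ := this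
          rw [h6] at hy
          exact hy
        rw [φ.tsupport_normed_eq] at h5
        rw [Metric.mem_closedBall, dist_comm, dist_eq_norm]
        simpa using h5
    · have := (hφc.fderiv ℝ).convolutionExists_left
        (ContinuousLinearMap.precompL (Euc n) (ContinuousLinearMap.lsmul ℝ ℝ))
        (hφ.continuous_fderiv (by simp)) hF z
      exact this.integrable_swap
  have := hS.norm_image_sub_le_of_norm_hasFDerivWithin_le (f := G) (f' := fun _ => 0) (C := 0)
    (fun z hz => (hd z hz).hasFDerivWithinAt) (by simp) hy hx
  simpa [sub_eq_zero] using this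

/-- A function that is constant on each of two nonempty open sets covering almost all of a convex
open set, and that has locally integrable weak derivatives there, has no jump. -/
lemma eq_of_weakDeriv_of_piecewise_const {Q U V : Set (Euc n)} (hQ : Convex ℝ Q)
    (hU : IsOpen U) (hV : IsOpen V) (hUQ : U ⊆ Q) (hVQ : V ⊆ Q) (hUV : Disjoint U V)
    (hUn : U.Nonempty) (hVn : V.Nonempty) (hnull : volume (Q \ (U ∪ V)) = 0)
    {f : Euc n → ℝ} {a b : ℝ} (hfa : ∀ᵐ y, y ∈ U → f y = a) (hfb : ∀ᵐ y, y ∈ V → f y = b)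
    {h : Euc n → Euc n → ℝ} (hint : ∀ v, LocallyIntegrableOn (h v) Q)
    (hw : ∀ (v : Euc n) (η : Euc n → ℝ), ContDiff ℝ ∞ η → HasCompactSupport η → tsupport η ⊆ Q →
      ∫ y, f y * fderiv ℝ η y v = - ∫ y, h v y * η y) : a = b := by
  classical
  have hcov : ∀ᵐ y, y ∈ Q → y ∈ U ∨ y ∈ V := by
    rw [ae_iff]
    convert hnull using 2
    ext y
    simp
    tauto
  -- As the weak derivatives are functions, the null set outside `U ∪ V` does not contribute.
  have hz : ∀ v, ∀ᵐ y, y ∈ Q → h v y = 0 := by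
    intro v
    have h1 := weakDeriv_ae_eq_zero_of_ae_const hU hfa ((hint v).mono_set hUQ)
      fun η hη hc hs => hw v η hη hc (hs.trans hUQ)
    have h2 := weakDeriv_ae_eq_zero_of_ae_const hV hfb ((hint v).mono_set hVQ)
      fun η hη hc hs => hw v η hη hc (hs.trans hVQ)
    filter_upwards [h1, h2, hcov] with y h1 h2 h3 hy
    exact (h3 hy).elim h1 h2
  -- A representative of `f` on `Q` that is locally integrable on the whole space, as convolution
  -- needs, and takes its two values pointwise.
  set F : Euc n → ℝ := U.indicator (fun _ => a) + V.indicator (fun _ => b) with hFdef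
  have hF : LocallyIntegrable F :=
    ((locallyIntegrable_const a).indicator hU.measurableSet).add
      ((locallyIntegrable_const b).indicator hV.measurableSet)
  have hFU : ∀ y ∈ U, F y = a := fun y hy => by
    simp [hFdef, hy, hUV.notMem_of_mem_left hy]
  have hFV : ∀ y ∈ V, F y = b := fun y hy => by
    simp [hFdef, hy, hUV.notMem_of_mem_right hy]
  have hwF : ∀ (v : Euc n) (η : Euc n → ℝ), ContDiff ℝ ∞ η → HasCompactSupport η →
      tsupport η ⊆ Q → ∫ y, F y * fderiv ℝ η y v = 0 := by
    intro v η hη hc hs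
    have h1 : ∫ y, F y * fderiv ℝ η y v = ∫ y, f y * fderiv ℝ η y v := by
      refine integral_congr_ae ?_
      filter_upwards [hcov, hfa, hfb] with y h1 h2 h3
      by_cases hy : y ∈ Q
      · rcases h1 hy with h | h
        · simp only [h2 h, hFU y h]
        · simp only [h3 h, hFV y h]
      · simp [fderiv_apply_eq_zero_of_notMem_tsupport (fun h => hy (hs h)) v]
    have h2 : ∫ y, h v y * η y = 0 := by
      refine integral_eq_zero_of_ae ?_
      filter_upwards [hz v] with y h1
      by_cases hy : y ∈ Q
      · simp [h1 hy]
      · simp [image_eq_zero_of_notMem_tsupport (fun h => hy (hs h))]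
    rw [h1, hw v η hη hc hs, h2, neg_zero]
  obtain ⟨x, hx⟩ := hUn
  obtain ⟨y, hy⟩ := hVn
  obtain ⟨r, hr, hrU⟩ := Metric.nhds_basis_closedBall.mem_iff.1 (hU.mem_nhds hx)
  obtain ⟨s, hs, hsV⟩ := Metric.nhds_basis_closedBall.mem_iff.1 (hV.mem_nhds hy)
  -- The outer radius fits both balls, so mollifying at `x` and `y` returns exactly `a` and `b`.
  let φ : ContDiffBump (0 : Euc n) := ⟨min r s / 2, min r s, by positivity, by
    have : 0 < min r s := lt_min hr hs
    linarith⟩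
  have hxU : Metric.closedBall x φ.rOut ⊆ U :=
    (Metric.closedBall_subset_closedBall (min_le_left _ _)).trans hrU
  have hyV : Metric.closedBall y φ.rOut ⊆ V :=
    (Metric.closedBall_subset_closedBall (min_le_right _ _)).trans hsV
  have key := normed_convolution_eq_of_weakDeriv_eq_zero hF φ hwF (convex_segment x y) ?_
    (left_mem_segment ℝ x y) (right_mem_segment ℝ x y)
  · rw [φ.normed_convolution_eq_right, φ.normed_convolution_eq_right, hFU x hx, hFV y hy] at key
    · exact key
    · exact fun z hz => by rw [hFV y hy, hFV z (hyV (Metric.ball_subset_closedBall hz))]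
    · exact fun z hz => by rw [hFU x hx, hFU z (hxU (Metric.ball_subset_closedBall hz))]
  -- A point at offset `d` from the segment is the same convex combination of `x + d` and `y + d`,
  -- which lie in `Q`.
  · rintro z ⟨α, β, hα, hβ, hαβ, rfl⟩ w hw
    set d := w - (α • x + β • y) with hd
    have hdn : ‖d‖ ≤ φ.rOut := by simpa [dist_eq_norm] using hw
    have h1 : x + d ∈ Q := hUQ (hxU (by simpa using hdn))
    have h2 : y + d ∈ Q := hVQ (hyV (by simpa using hdn))
    have h3 := hQ h1 h2 hα hβ hαβ
    have h4 : α • (x + d) + β • (y + d) = w := by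
      have : α • (x + d) + β • (y + d) = (α • x + β • y) + (α + β) • d := by module
      rw [this, hαβ, hd]
      simp
    rwa [h4] at h3

end JumpFunctions

/-! ### No jump at a Lipschitz boundary point -/

section LipschitzBoundary

/-- The coordinates `c` force `n = (n - 1) + 1`, which fails for `n = 0` under truncated
subtraction. -/
lemma IsLipschitzTriple.pos {n : ℕ} {U Γ : Set (Euc n)} {V : Set (Euc (n - 1))}
    (h : IsLipschitzTriple U Γ V) : 0 < n := by
  obtain ⟨-, -, -, c, -⟩ := h
  have h1 := (c.toLinearEquiv.trans (WithLp.linearEquiv 2 ℝ _)).finrank_eq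
  simp only [finrank_euclideanSpace, Fintype.card_fin, Module.finrank_prod, Module.finrank_self]
    at h1
  omega

/-- The Lipschitz graph in a Lipschitz triple is a Lebesgue null set. -/
lemma IsLipschitzTriple.volume_graph_eq_zero {n : ℕ} {U Γ : Set (Euc n)} {V : Set (Euc (n - 1))}
    (h : IsLipschitzTriple U Γ V) : volume Γ = 0 := by
  have hn := h.pos
  obtain ⟨-, -, -, c, w, w', L, hw, -, -, hΓ⟩ := h
  let T : Euc (n - 1) × ℝ →L[ℝ] Euc n :=
    (c.symm.toContinuousLinearEquiv : _ →L[ℝ] Euc n).comp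
      ((WithLp.prodContinuousLinearEquiv 2 ℝ (Euc (n - 1)) ℝ).symm :
        Euc (n - 1) × ℝ →L[ℝ] WithLp 2 (Euc (n - 1) × ℝ))
  have hT : ∀ x, T x = c.symm (WithLp.toLp 2 x) := fun x => rfl
  have hlip := T.lipschitz.comp_lipschitzOnWith
    ((LipschitzWith.id.lipschitzOnWith (s := V)).prodMk hw)
  have hsub : Γ ⊆ (T ∘ fun x => (id x, w x)) '' V := by
    intro z hz
    rw [hΓ] at hz
    refine ⟨(c z).fst, hz.1, ?_⟩
    simp only [Function.comp_apply, id, hT, ← hz.2]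
    exact c.symm_apply_apply z
  -- `Γ` lies in a Lipschitz image of a subset of `(n-1)`-dimensional space.
  have hdim : dimH Γ < (n : NNReal) := by
    calc dimH Γ ≤ dimH ((T ∘ fun x => (id x, w x)) '' V) := dimH_mono hsub
      _ ≤ dimH V := hlip.dimH_image_le
      _ ≤ dimH (univ : Set (Euc (n - 1))) := dimH_mono (subset_univ _)
      _ = ((n - 1 : ℕ) : ENNReal) := by rw [Real.dimH_univ_eq_finrank]; simp
      _ < (n : NNReal) := by
        rw [ENNReal.coe_natCast]
        exact_mod_cast (by omega : n - 1 < n)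
  refine measure_zero_of_dimH_lt ?_ hdim
  have hH : (Measure.hausdorffMeasure ((n : NNReal) : ℝ) : Measure (Euc n)).IsAddHaarMeasure := by
    simpa using MeasureTheory.isAddHaarMeasure_hausdorffMeasure (E := Euc n)
  exact Measure.absolutelyContinuous_isAddHaarMeasure _ _

variable {n : ℕ} {M : Type*} [TopologicalSpace M]

/-- Near a Lipschitz boundary point of `D`, there are points outside the closure of `D`. -/
lemma exists_mem_notMem_closure_of_isLipschitzTriple {D : Set M} {p : M}
    (hp : p ∈ frontier D) {ψ : OpenPartialHomeomorph M (Euc n)} (hpψ : p ∈ ψ.source)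
    {V : Set (Euc (n - 1))}
    (h : IsLipschitzTriple (ψ '' (D ∩ ψ.source)) (ψ '' (frontier D ∩ ψ.source)) V)
    {Q : Set (Euc n)} (hQ : Q ∈ 𝓝 (ψ p)) (hQψ : Q ⊆ ψ.target) :
    ∃ z ∈ Q, ψ.symm z ∉ closure D := by
  obtain ⟨-, -, -, c, w, w', L, -, -, hU, hΓ⟩ := h
  have hpΓ : ψ p ∈ ψ '' (frontier D ∩ ψ.source) := mem_image_of_mem _ ⟨hp, hpψ⟩
  rw [hΓ] at hpΓ
  -- Descend vertically from the graph: for `t > 0` the point is neither above the graph nor on it,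
  -- so it corresponds to no point of `D` or of its frontier.
  let γ : ℝ → Euc n := fun t => c.symm (WithLp.toLp 2 ((c (ψ p)).fst, w (c (ψ p)).fst - t))
  have hγ : Continuous γ := by
    refine c.symm.continuous.comp ?_
    refine (WithLp.prod_continuous_toLp 2 _ _).comp (by fun_prop)
  have hγ0 : γ 0 = ψ p := by
    simp only [γ, sub_zero, ← hpΓ.2]
    exact c.symm_apply_apply _
  have hev : ∀ᶠ t in 𝓝[>] (0 : ℝ), γ t ∈ Q :=
    nhdsWithin_le_nhds (hγ.continuousAt (by rwa [hγ0]))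
  obtain ⟨t, htQ, ht⟩ := (hev.and self_mem_nhdsWithin).exists
  have hct : c (γ t) = WithLp.toLp 2 ((c (ψ p)).fst, w (c (ψ p)).fst - t) := by simp [γ]
  have htt := hQψ htQ
  refine ⟨γ t, htQ, fun hcl => ?_⟩
  rw [closure_eq_self_union_frontier] at hcl
  rcases hcl with hcl | hcl
  · have : γ t ∈ ψ '' (D ∩ ψ.source) := ⟨_, ⟨hcl, ψ.map_target htt⟩, ψ.right_inv htt⟩
    rw [hU] at this
    have h1 := this.2.1
    simp only [hct] at h1
    have h2 : w (c (ψ p)).fst < w (c (ψ p)).fst - t := h1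
    linarith
  · have : γ t ∈ ψ '' (frontier D ∩ ψ.source) := ⟨_, ⟨hcl, ψ.map_target htt⟩, ψ.right_inv htt⟩
    rw [hΓ] at this
    have h1 := this.2
    simp only [hct] at h1
    have h2 : w (c (ψ p)).fst - t = w (c (ψ p)).fst := h1
    linarith

variable [ChartedSpace (Euc n) M] [IsManifold (𝓡 n) ∞ M] [MeasurableSpace M] [BorelSpace M]

/-- A function of class `W^{1,2}` has no jump across a boundary with a Lipschitz point. -/
lemma MemW12.eq_of_isLipschitzAt {g : SmoothMetric n M} {D : Set M} (hD : IsOpen D) {p : M}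
    (hp : p ∈ frontier D) (hL : IsLipschitzAt (n := n) D p) {u : M → ℝ} (hu : MemW12 g u)
    {a b : ℝ} (ha : ∀ᵐ x ∂(riemannianVolume g), x ∈ D → u x = a)
    (hb : ∀ᵐ x ∂(riemannianVolume g), x ∈ Dᶜ → u x = b) : a = b := by
  obtain ⟨ψ, hψ, hpψ, V, hT⟩ := hL
  obtain ⟨-, X, hX, hX2⟩ := hu
  obtain ⟨r, hr, hrψ⟩ := Metric.isOpen_iff.1 ψ.open_target _ (ψ.map_source hpψ)
  set Q := Metric.ball (ψ p) r with hQdef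
  have hopen : ∀ E : Set M, IsOpen E → IsOpen (Q ∩ (ψ.target ∩ ψ.symm ⁻¹' E)) := fun E hE =>
    Metric.isOpen_ball.inter (ψ.isOpen_inter_preimage_symm hE)
  have hmeas : MeasurableSet ψ.target := ψ.open_target.measurableSet
  have ha' := (ae_restrict_iff' hmeas).1 (ae_chart_of_ae_riemannianVolume g hψ ha)
  have hb' := (ae_restrict_iff' hmeas).1 (ae_chart_of_ae_riemannianVolume g hψ hb)
  refine eq_of_weakDeriv_of_piecewise_const (Q := Q)
    (U := Q ∩ (ψ.target ∩ ψ.symm ⁻¹' D)) (V := Q ∩ (ψ.target ∩ ψ.symm ⁻¹' (closure D)ᶜ))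
    (f := fun y => u (ψ.symm y))
    (h := fun v y => g.inner (ψ.symm y) (X (ψ.symm y)) (coordVec ψ y v))
    (convex_ball _ _) (hopen D hD) (hopen _ isClosed_closure.isOpen_compl)
    inter_subset_left inter_subset_left ?_ ?_ ?_ ?_ ?_ ?_ ?_ ?_
  · rw [Set.disjoint_left]
    exact fun y hy hy' => hy'.2.2 (subset_closure hy.2.2)
  · have h1 : ψ.source ∩ ψ ⁻¹' Q ∈ 𝓝 p :=
      (ψ.isOpen_inter_preimage Metric.isOpen_ball).mem_nhds ⟨hpψ, Metric.mem_ball_self hr⟩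
    obtain ⟨x, hx, hxD⟩ := mem_closure_iff_nhds.1 (frontier_subset_closure hp) _ h1
    exact ⟨ψ x, hx.2, ψ.map_source hx.1, by simpa [ψ.left_inv hx.1] using hxD⟩
  · obtain ⟨z, hz, hz'⟩ := exists_mem_notMem_closure_of_isLipschitzTriple hp hpψ hT
      (Metric.ball_mem_nhds _ hr) hrψ
    exact ⟨z, hz, hrψ hz, hz'⟩
  -- As `D` is open, what remains of the ball is in the image of the frontier, that is, in the
  -- graph.
  · refine measure_mono_null (fun y hy => ?_) hT.volume_graph_eq_zero
    have hyt := hrψ hy.1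
    refine ⟨ψ.symm y, ⟨?_, ψ.map_target hyt⟩, ψ.right_inv hyt⟩
    rw [hD.frontier_eq]
    exact ⟨by_contra fun h => hy.2 (Or.inr ⟨hy.1, hyt, h⟩),
      fun h => hy.2 (Or.inl ⟨hy.1, hyt, h⟩)⟩
  · filter_upwards [ha'] with y h1 h2 using h1 h2.2.1 h2.2.2
  · filter_upwards [hb'] with y h1 h2
    exact h1 h2.2.1 fun h => h2.2.2 (subset_closure h)
  · exact fun v =>
      (locallyIntegrableOn_inner_coordVec g hψ hX2 v (hX ψ hψ v).1).mono_set hrψ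
  · intro v η hη hc hs
    have h1 := (hX ψ hψ v).2 η hη hc (hs.trans hrψ)
    rwa [setIntegral_eq_integral_of_forall_compl_eq_zero,
      setIntegral_eq_integral_of_forall_compl_eq_zero] at h1
    · intro y hy
      rw [image_eq_zero_of_notMem_tsupport fun h => hy (hrψ (hs h)), mul_zero]
    · intro y hy
      rw [fderiv_apply_eq_zero_of_notMem_tsupport (fun h => hy (hrψ (hs h))) v, mul_zero]

end LipschitzBoundary

/-! ### Existence of a Lipschitz boundary point -/

section ExistenceOfLipschitzPoints

variable {n : ℕ} {N : Type*} [TopologicalSpace N]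

/-- In a chart in which `Ω` is an open half-space, the boundary hyperplane lies in the frontier
of `Ω`. -/
lemma mem_frontier_of_apply_eq_zero {Ω : Set N} {e : OpenPartialHomeomorph N (Euc n)} {i : Fin n}
    (h : ∀ x ∈ e.source, x ∈ Ω ↔ 0 < e x i) {x : N} (hx : x ∈ e.source) (hxi : e x i = 0) :
    x ∈ frontier Ω := by
  -- Moving along the inward normal coordinate approximates `x` from within `Ω`.
  let γ : ℝ → Euc n := fun t => e x + t • EuclideanSpace.single i (1 : ℝ)
  have hγ : Continuous γ := by fun_prop
  have hγ0 : γ 0 = e x := by simp [γ]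
  have hmem : ∀ᶠ t in 𝓝[>] (0 : ℝ), γ t ∈ e.target :=
    nhdsWithin_le_nhds (hγ.continuousAt (by
      rw [hγ0]; exact e.open_target.mem_nhds (e.map_source hx)))
  have hlim : Filter.Tendsto (fun t => e.symm (γ t)) (𝓝[>] (0 : ℝ)) (𝓝 x) := by
    have h1 : ContinuousAt e.symm (γ 0) := by
      rw [hγ0]; exact e.continuousAt_symm (e.map_source hx)
    have h2 := (h1.comp hγ.continuousAt).tendsto
    simp only [Function.comp_apply, hγ0, e.left_inv hx] at h2
    exact h2.mono_left nhdsWithin_le_nhds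
  refine ⟨mem_closure_of_tendsto hlim ?_, fun hi => ?_⟩
  · filter_upwards [hmem, self_mem_nhdsWithin] with t ht ht0
    rw [h _ (e.map_target ht), e.right_inv ht]
    simpa [γ, hxi] using ht0
  · have := (h x hx).1 (interior_subset hi)
    linarith

/-- If a continuous map takes finitely many values on the boundary of a domain with a half-space
chart at `q`, then it is constant along short coordinate curves in the boundary. -/
lemma eventually_mem_preglued {M : Type*} [TopologicalSpace M] [T1Space M]
    {Ω : Set N} {e : OpenPartialHomeomorph N (Euc n)} {i j : Fin n} (hij : j ≠ i)
    (h : ∀ x ∈ e.source, x ∈ Ω ↔ 0 < e x i) {q : N} (hq : q ∈ e.source) (hqi : e q i = 0)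
    {φ : N → M} (hφ : ContinuousAt φ q) (hfin : (φ '' frontier Ω).Finite) :
    ∀ᶠ t in 𝓝 (0 : ℝ), e q + t • EuclideanSpace.single j (1 : ℝ) ∈ e.target ∧
      e.symm (e q + t • EuclideanSpace.single j (1 : ℝ)) ∈ preglued φ Ω (φ q) := by
  set γ : ℝ → Euc n := fun t => e q + t • EuclideanSpace.single j (1 : ℝ) with hγdef
  have hγ : Continuous γ := by fun_prop
  have hγ0 : γ 0 = e q := by simp [γ]
  have hmem : ∀ᶠ t in 𝓝 (0 : ℝ), γ t ∈ e.target :=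
    hγ.continuousAt (by rw [hγ0]; exact e.open_target.mem_nhds (e.map_source hq))
  have hlim : Filter.Tendsto (fun t => e.symm (γ t)) (𝓝 (0 : ℝ)) (𝓝 q) := by
    have h1 : ContinuousAt e.symm (γ 0) := by
      rw [hγ0]; exact e.continuousAt_symm (e.map_source hq)
    have h2 := (h1.comp hγ.continuousAt).tendsto
    simp only [Function.comp_apply, hγ0, e.left_inv hq] at h2
    exact h2
  -- The other values of `φ` on the boundary form a finite, hence closed, set that misses `φ q`.
  have hav : ∀ᶠ t in 𝓝 (0 : ℝ), φ (e.symm (γ t)) ∈ ((φ '' frontier Ω) \ {φ q})ᶜ :=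
    (hφ.tendsto.comp hlim) (hfin.sdiff.isClosed.isOpen_compl.mem_nhds (by simp))
  filter_upwards [hmem, hav] with t ht htav
  have hfr : e.symm (γ t) ∈ frontier Ω := by
    refine mem_frontier_of_apply_eq_zero h (e.map_target ht) ?_
    rw [e.right_inv ht]
    simp [γ, hqi, hij.symm]
  refine ⟨ht, hfr, ?_⟩
  by_contra hne
  exact htav ⟨mem_image_of_mem _ hfr, hne⟩

/-- In a half-space chart, boundary points have vanishing normal coordinate. -/
lemma apply_eq_zero_of_mem_frontier {Ω : Set N} (hΩ : IsOpen Ω)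
    {e : OpenPartialHomeomorph N (Euc n)} {i : Fin n}
    (h : ∀ x ∈ e.source, x ∈ Ω ↔ 0 < e x i) {x : N} (hx : x ∈ e.source) (hf : x ∈ frontier Ω) :
    e x i = 0 := by
  rw [hΩ.frontier_eq] at hf
  refine le_antisymm (not_lt.1 fun h0 => hf.2 ((h x hx).2 h0)) (not_lt.1 fun h0 => ?_)
  have hev : ∀ᶠ y in 𝓝 x, y ∈ e.source ∧ e y i < 0 := by
    refine Filter.Eventually.and (e.open_source.mem_nhds hx) ?_
    have hc : ContinuousAt (fun y => e y i) x :=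
      (EuclideanSpace.proj (𝕜 := ℝ) i).continuous.continuousAt.comp (e.continuousAt hx)
    exact hc.eventually (gt_mem_nhds h0)
  obtain ⟨y, hy, hyΩ⟩ := mem_closure_iff_nhds.1 hf.1 _ hev
  have := (h y hy.1).1 hyΩ
  linarith [hy.2]

variable {M : Type*} [TopologicalSpace M] [T2Space M] [ChartedSpace (Euc n) M]
  [IsManifold (𝓡 n) ∞ M] [ChartedSpace (Euc n) N]

/-- The boundary of a glued domain does not consist of finitely many glued points. -/
lemma IsGluingMap.not_frontier_subset {g : SmoothMetric n M} {φ : N → M} {Ω : Set N} {D : Set M}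
    (h : IsGluingMap g φ Ω D) (hne : (frontier D).Nonempty) {P : Set M} (hP : P.Finite)
    (hglued : ∀ p ∈ P, IsGluedPoint g φ Ω D p) : ¬ frontier D ⊆ P := by
  intro hsub
  have hfin : (φ '' frontier Ω).Finite := by rw [h.image_frontier]; exact hP.subset hsub
  obtain ⟨p, hp⟩ := hne
  have hpP := hsub hp
  rw [← h.image_frontier] at hp
  obtain ⟨q, hq, rfl⟩ := hp
  obtain ⟨Ω', hΩ', hcl, hφ⟩ := h.smooth_extension
  have hφq : ContinuousAt φ q :=
    hφ.continuousOn.continuousAt (hΩ'.mem_nhds (hcl (frontier_subset_closure hq)))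
  obtain ⟨k, hk, hα, -⟩ := hglued _ hpP
  rcases hα with ⟨-, hα⟩ | ⟨-, hα, -⟩
  · obtain ⟨e, -, hqe, i, hei⟩ := h.smooth_boundary q hq
    -- `k + 1 < n` gives `n ≥ 2`, so a direction tangent to the boundary exists; moving along it
    -- yields infinitely many preglued points.
    have : Nontrivial (Fin n) := Fin.nontrivial_iff_two_le.2 (by omega)
    obtain ⟨j, hij⟩ := exists_ne i
    have hev := eventually_mem_preglued hij hei hqe
      (apply_eq_zero_of_mem_frontier h.isOpen_sample hei hqe hq) hφq hfin
    obtain ⟨ε, hε, hball⟩ := Metric.eventually_nhds_iff_ball.1 hev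
    refine (infinite_of_injOn_mapsTo (s := Metric.ball (0 : ℝ) ε)
      (f := fun t => e.symm (e q + t • EuclideanSpace.single j (1 : ℝ))) ?_
      (fun t ht => (hball t ht).2) ?_) hα
    · intro s hs t ht hst
      have h1 := e.symm.injOn (hball s hs).1 (hball t ht).1 hst
      have h2 := congrArg (fun z : Euc n => z j) h1
      simpa using h2
    · exact infinite_of_mem_nhds 0 (Metric.ball_mem_nhds _ hε)
  · obtain ⟨e, -, hqe, i, s, his, hcard, hei, heα⟩ := hα.2 q ⟨hq, rfl⟩
    have hq0 := (heα q hqe).1 ⟨hq, rfl⟩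
    -- `s.card = n - k > 1`, so some coordinate other than the normal one also vanishes on the
    -- preglued set; moving along it must leave that set.
    obtain ⟨j, hjs, hji⟩ := Finset.exists_mem_ne (by omega : 1 < s.card) i
    have hev := eventually_mem_preglued hji hei hqe (hq0 i his) hφq hfin
    obtain ⟨t, ⟨ht, htα⟩, ht0⟩ :=
      ((hev.filter_mono nhdsWithin_le_nhds).and (self_mem_nhdsWithin (s := Ioi (0 : ℝ)))).exists
    have h1 := (heα _ (e.map_target ht)).1 htα j hjs
    rw [e.right_inv ht] at h1
    simp [hq0 j hjs] at h1
    exact (ne_of_gt ht0) h1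

/-- A quasi-Lipschitz domain with nonempty boundary has a Lipschitz boundary point. -/
lemma IsQuasiLipschitzDomain.exists_isLipschitzAt {g : SmoothMetric n M} {D : Set M}
    (hD : IsQuasiLipschitzDomain g D) (hne : (frontier D).Nonempty) :
    ∃ p ∈ frontier D, IsLipschitzAt (n := n) D p := by
  obtain ⟨-, -, N, _, _, _, _, _, φ, Ω, h⟩ := hD
  obtain ⟨P, hP, -, hglued, -, hlip⟩ := h.glued
  obtain ⟨p, hp, hpP⟩ := not_subset.1 (h.not_frontier_subset hne hP hglued)
  exact ⟨p, hp, hlip p ⟨hp, hpP⟩⟩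

end ExistenceOfLipschitzPoints

end QuasiLip

theorem corollary3p1 {n : ℕ} {M : Type*} [TopologicalSpace M] [T2Space M]
    [SecondCountableTopology M] [ChartedSpace (QuasiLip.Euc n) M] [IsManifold (𝓡 n) ∞ M]
    [MeasurableSpace M] [BorelSpace M] (g : QuasiLip.SmoothMetric n M) (D : Set M)
    (hD : QuasiLip.IsQuasiLipschitzDomain g D) (hDc : IsCompact (closure D))
    (hDb : (frontier D).Nonempty) (a b : ℝ) (hab : a ≠ b) :
    ¬ ∃ u : M → ℝ, QuasiLip.MemW12 g u ∧
      (∀ᵐ x ∂(QuasiLip.riemannianVolume g), x ∈ D → u x = a) ∧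
      (∀ᵐ x ∂(QuasiLip.riemannianVolume g), x ∈ Dᶜ → u x = b) := by
  rintro ⟨u, hu, ha, hb⟩
  obtain ⟨p, hp, hL⟩ := hD.exists_isLipschitzAt hDb
  exact hab (hu.eq_of_isLipschitzAt hD.1 hp hL ha hb)
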